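/- Let $N,k$ be integers with $1\le k\le N-1$, and let $|D_k^N\rangle=\binom{N}{k}^{-1/2}\sum_{s\in\{0,1\}^N,\ |s|=k}|s\rangle$ be the $N$-qubit Dicke state with $k$ excitations. (a) Let $\{i,j\}$ be any pair of distinct parties, and let the other $N-2$ parties be measured one after the other, in any order, by the following adaptive protocol. Keep track of the number $M$ of parties not yet measured (including $i$ and $j$) and of $k'$, equal to $k$ minus the number of $Z$ measurements so far with outcome $|1\rangle$. While $k'\notin\{1,M-1\}$, the next party is measured in the eigenbasis $\{|0\rangle,|1\rangle\}$ of the Pauli operator $Z$; as soon as $k'\in\{1,M-1\}$, all remaining parties other than $i,j$ are measured in the eigenbasis of the Pauli operator $X$. Then, in every branch of the protocol (every sequence of outcomes of nonzero probability), the pair $(i,j)$ is left, up to a global phase, in a pure state $$\chi=a\,(|01\rangle+|10\rangle)+\sqrt{1-2a^2}\,|00\rangle\quad\text{or}\quad \chi=a\,(|01\rangle+|10\rangle)+\sqrt{1-2a^2}\,|11\rangle$$ with $a$ real, $a\neq0$ and $2a^2\le1$ ($a$ may depend on the branch), and $\chi$ is entangled, i.e. not a product vector. (b) Consequently, the genuine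 multipartite entanglement of $|D_k^N\rangle$ can be detected in a device-independent way. That is, there are finite numbers of settings and outcomes per party, real coefficients $B(x,a)$, indexed by the setting strings $x=(x_1,\dots,x_N)$ and the outcome strings $a=(a_1,\dots,a_N)$, and a real number $\beta$ such that - for all finite local dimensions $d_1,\dots,d_N$, every biseparable state $\varrho$ on $\bigotimes_{i=1}^N\mathbb C^{d_i}$ and all local POVMs $\{M^{(i)}_{a_i|x_i}\}_{a_i}$, $$\sum_{x,a}B(x,a)\,\mathrm{tr}\Big(\varrho\,\bigotimes_{i=1}^N M^{(i)}_{a_i|x_i}\Big)\le\beta,$$ where $\varrho$ is called biseparable if it is a convex combination of product states $\rho_{g}\otimes\rho_{g^c}$ of density operators over splittings of the $N$ parties into two nonempty groups $g,g^c$, which may differ from term to term; - for suitable local qubit POVMs the same Bell expression has a value strictly larger than $\beta$ on $|D_k^N\rangle$. -/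

import Mathlib

open scoped BigOperators ComplexConjugate ComplexOrder

noncomputable section

namespace DickeGME

/-! ### Qubit registers and Dicke states -/

/-- Vectors of the `N`-qubit space, given by their coefficients in the computational basis. -/
abbrev QVec (N : ℕ) : Type := (Fin N → Fin 2) → ℂ

/-- The Dicke state with `k` excitations: the uniform superposition of all computational basis
states of `N` qubits that have exactly `k` ones. -/
def dicke (N k : ℕ) : QVec N := fun s =>
  if (Finset.univ.filter fun i => s i = 1).card = k then
    (((Real.sqrt (N.choose k : ℝ))⁻¹ : ℝ) : ℂ) else 0

/-- The squared norm of a vector. -/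
def normSq {ι : Type} [Fintype ι] (ψ : ι → ℂ) : ℝ := ∑ s, ‖ψ s‖ ^ 2

/-! ### Adaptive Pauli measurements -/

inductive Pauli : Type
  | X
  | Z

/-- The eigenbasis of a Pauli operator. Outcome `0` is the `+1` eigenvector, outcome `1` is the
`-1` eigenvector: `|0⟩, |1⟩` for `Z` and `(|0⟩ ± |1⟩)/√2` for `X`. -/
def Pauli.eigenvec : Pauli → Fin 2 → Fin 2 → ℂ
  | .Z, m => fun x => if x = m then 1 else 0
  | .X, m => fun x => (((Real.sqrt 2)⁻¹ : ℝ) : ℂ) * (if m = 1 ∧ x = 1 then -1 else 1)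

/-- The operator `|v⟩⟨v|` on qubit `p`, identity on all other qubits, applied to `ψ`. -/
def projectQubit {N : ℕ} (p : Fin N) (v : Fin 2 → ℂ) (ψ : QVec N) : QVec N := fun s =>
  v (s p) * ∑ x : Fin 2, conj (v x) * ψ (Function.update s p x)

/-- The Born probability of outcome `m` when qubit `p` of the unit vector `ψ` is measured. -/
def outcomeProb {N : ℕ} (p : Fin N) (B : Pauli) (m : Fin 2) (ψ : QVec N) : ℝ :=
  normSq (projectQubit p (B.eigenvec m) ψ)

/-- The normalized state after outcome `m` (used only for outcomes of nonzero probability). -/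
def postState {N : ℕ} (p : Fin N) (B : Pauli) (m : Fin 2) (ψ : QVec N) : QVec N := fun s =>
  (((Real.sqrt (outcomeProb p B m ψ))⁻¹ : ℝ) : ℂ) * projectQubit p (B.eigenvec m) ψ s

/-- Adaptive protocols of single-qubit Pauli measurements with classical communication: a
decision tree, whose continuation depends on the outcomes announced so far. -/
inductive Protocol (N : ℕ) : Type
  | done : Protocol N
  | measure (p : Fin N) (B : Pauli) (next : Fin 2 → Protocol N) : Protocol N

/-- `P.EveryBranch Q ψ`: whichever outcomes (of nonzero probability) occur when `P` is run on
`ψ`, the final normalized state satisfies `Q`. -/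
def Protocol.EveryBranch {N : ℕ} (Q : QVec N → Prop) : Protocol N → QVec N → Prop
  | .done, ψ => Q ψ
  | .measure p B next, ψ =>
      ∀ m : Fin 2, outcomeProb p B m ψ ≠ 0 → (next m).EveryBranch Q (postState p B m ψ)

/-- Measure `X` on all listed qubits. -/
def xProtocol {N : ℕ} : List (Fin N) → Protocol N
  | [] => .done
  | p :: l => .measure p .X fun _ => xProtocol l

/-- The listed qubits are measured in turn, and two more qubits are kept. The number `k` is the
current number of excitations, so the current number of qubits is `M = l.length + 3` when the list
is `p :: l`. As long as `k` is neither `1` nor `M - 1`, the next qubit is measured in the `Z` basis,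
and outcome `|1⟩` lowers the excitation number by one. As soon as `k` is `1` or `M - 1`, all
remaining listed qubits are measured in the `X` basis. -/
def zxProtocol {N : ℕ} : ℕ → List (Fin N) → Protocol N
  | _, [] => .done
  | k, p :: l =>
      if k = 1 ∨ k = (l.length + 3) - 1 then xProtocol (p :: l)
      else .measure p .Z fun m => zxProtocol (k - m.val) l

/-! ### States of a pair -/

/-- `a (|01⟩ + |10⟩) + √(1 - 2a²) |ee⟩`. -/
def chi (a : ℝ) (e : Fin 2) : Fin 2 → Fin 2 → ℂ := fun x y =>
  if x ≠ y then (a : ℂ) else if x = e then ((Real.sqrt (1 - 2 * a ^ 2) : ℝ) : ℂ) else 0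

/-- The pair `(i, j)` is in the pure state `χ`: the global state is `χ` on `i, j` tensored with
some unit vector on the other qubits (which absorbs the global phase). -/
def PairInState {N : ℕ} (ψ : QVec N) (i j : Fin N) (χ : Fin 2 → Fin 2 → ℂ) : Prop :=
  ∃ φ : ({p : Fin N // p ≠ i ∧ p ≠ j} → Fin 2) → ℂ,
    normSq φ = 1 ∧ ∀ s, ψ s = χ (s i) (s j) * φ (fun p => s p)

/-- A pure two-qubit state is entangled when it is not a product vector. -/
def EntangledPair (χ : Fin 2 → Fin 2 → ℂ) : Prop :=
  ¬ ∃ u v : Fin 2 → ℂ, ∀ x y, χ x y = u x * v y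

/-! ### Biseparable states and device-independent detection -/

/-- Density operators. -/
def IsDensity {ι : Type} [Fintype ι] (ρ : Matrix ι ι ℂ) : Prop :=
  ρ.PosSemidef ∧ ρ.trace = 1

/-- `σ ⊗ τ`, with `σ` a state of the parties in `g` and `τ` a state of the other parties. -/
def groupProduct {N : ℕ} {d : Fin N → ℕ} (g : Set (Fin N))
    (σ : Matrix (∀ i : {i // i ∈ g}, Fin (d i)) (∀ i : {i // i ∈ g}, Fin (d i)) ℂ)
    (τ : Matrix (∀ i : {i // i ∉ g}, Fin (d i)) (∀ i : {i // i ∉ g}, Fin (d i)) ℂ) :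
    Matrix (∀ i, Fin (d i)) (∀ i, Fin (d i)) ℂ :=
  Matrix.of fun s t => σ (fun i => s i) (fun i => t i) * τ (fun i => s i) (fun i => t i)

open Classical in
/-- Products of two density operators over a splitting of the parties in two nonempty groups. -/
def splitStates {N : ℕ} (d : Fin N → ℕ) :
    Set (Matrix (∀ i, Fin (d i)) (∀ i, Fin (d i)) ℂ) :=
  {ρ | ∃ g : Set (Fin N), g.Nonempty ∧ gᶜ.Nonempty ∧ ∃ σ τ,
    IsDensity σ ∧ IsDensity τ ∧ ρ = groupProduct g σ τ}

/-- Biseparable states: mixtures of product states, where different terms of the mixture may be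
products with respect to different splittings. -/
def IsBiseparable {N : ℕ} {d : Fin N → ℕ}
    (ρ : Matrix (∀ i, Fin (d i)) (∀ i, Fin (d i)) ℂ) : Prop :=
  ρ ∈ convexHull ℝ (splitStates d)

/-- Generalized measurements (POVMs) with `n` outcomes. -/
def IsPOVM {D n : ℕ} (E : Fin n → Matrix (Fin D) (Fin D) ℂ) : Prop :=
  (∀ a, (E a).PosSemidef) ∧ ∑ a, E a = 1

/-- Local measurements: for each party `i` and each of `m` settings `x`, a POVM with `n`
outcomes on the space `ℂ ^ (d i)` of that party. -/
structure LocalMeasurements {N : ℕ} (d : Fin N → ℕ) (m n : ℕ) where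
  effect : ∀ i : Fin N, Fin m → Fin n → Matrix (Fin (d i)) (Fin (d i)) ℂ
  isPOVM : ∀ i x, IsPOVM (effect i x)

/-- The tensor product of local operators. -/
def tensorOp {N : ℕ} {d : Fin N → ℕ} (A : ∀ i, Matrix (Fin (d i)) (Fin (d i)) ℂ) :
    Matrix (∀ i, Fin (d i)) (∀ i, Fin (d i)) ℂ :=
  Matrix.of fun s t => ∏ i, A i (s i) (t i)

/-- The probability of the outcomes `a` for the settings `x` in the state `ρ`. -/
def bornProb {N : ℕ} {d : Fin N → ℕ} {m n : ℕ}
    (ρ : Matrix (∀ i, Fin (d i)) (∀ i, Fin (d i)) ℂ) (E : LocalMeasurements d m n)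
    (x : Fin N → Fin m) (a : Fin N → Fin n) : ℝ :=
  (ρ * tensorOp fun i => E.effect i (x i) (a i)).trace.re

/-- The value of the Bell expression with coefficients `B`. -/
def bellValue {N : ℕ} {d : Fin N → ℕ} {m n : ℕ}
    (B : (Fin N → Fin m) → (Fin N → Fin n) → ℝ)
    (ρ : Matrix (∀ i, Fin (d i)) (∀ i, Fin (d i)) ℂ) (E : LocalMeasurements d m n) : ℝ :=
  ∑ x, ∑ a, B x a * bornProb ρ E x a

/-- The genuine multipartite entanglement of the pure state `ψ` is detectable in a
device-independent way: there is a Bell expression `B` whose value on every biseparable state, of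
arbitrary local dimensions and under arbitrary local measurements, is at most `β`, while suitable
local measurements on `ψ` give a value above `β`. -/
def DIDetectable {N : ℕ} (d : Fin N → ℕ) (ψ : (∀ i, Fin (d i)) → ℂ) : Prop :=
  ∃ (m n : ℕ) (B : (Fin N → Fin m) → (Fin N → Fin n) → ℝ) (β : ℝ),
    (∀ (d' : Fin N → ℕ) (ρ : Matrix (∀ i, Fin (d' i)) (∀ i, Fin (d' i)) ℂ)
      (E : LocalMeasurements d' m n), IsBiseparable ρ → bellValue B ρ E ≤ β) ∧
    ∃ E : LocalMeasurements d m n, β < bellValue B (Matrix.vecMulVec ψ (star ψ)) E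

end DickeGME

end

namespace DickeGME

/-! ### Adaptive measurements of Dicke states -/

/-! (a) A Dicke amplitude depends only on the number of ones, and this survives the measurements.
Let `U` be the set of unmeasured qubits. Up to a factor `h` independent of `U`, the state keeps the
amplitude `[count U 1 = k']` under `Z` measurements. When `k'` reaches `1` or `M - 1`, this is a W
state on `U`, in the second case with 0 and 1 exchanged. An `X` measurement maps `W + c|0…0⟩` to a
multiple of a smaller `W + c'|0…0⟩`; the W part never disappears, so the final pair is entangled
(`xProtocol_everyBranch`, `zxProtocol_everyBranch`).

(b) The Bell expression is built directly and does not use (a). Fix a party `i`. `hardyBell i`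
merges the Clauser-Horne expressions of all pairs `{i, j}`, the other parties having setting 0 and
outcome 0; the terms `p(0|0)` and `p(0|1_i)` are shared by all `j`. In a product over a splitting,
some `j` is separated from `i`; the Clauser-Horne inequality of that pair and nonnegativity of the
other terms give the bound 0, and linearity extends it to mixtures (`bellValue_hardyBell_le`).

For the violation, projecting all parties but `i`, `j` onto `(1, t)` leaves a symmetric real
two-qubit vector `!![A, B; B, C]`, the same for every `j`. One choice of Hardy vectors therefore
makes every subtracted term vanish while `p(0|0)` stays positive (`exists_hardy`,
`dicke_hardy_violation`). The case `N = 2` is maximally entangled and gets an explicit violation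
with nonzero subtracted terms. -/

/-- The number of qubits in `U` whose basis state is `e`. -/
def count {N : ℕ} (U : Finset (Fin N)) (e : Fin 2) (s : Fin N → Fin 2) : ℕ :=
  ∑ p ∈ U, if s p = e then 1 else 0

/-- `h` does not depend on the qubits in `U`. -/
def IndepOf {N : ℕ} (U : Finset (Fin N)) (h : QVec N) : Prop :=
  ∀ p ∈ U, ∀ s x, h (Function.update s p x) = h s

/-- The amplitudes of `|W⟩ + c |0…0⟩` as a function of the number of excitations. -/
noncomputable def wAmp (c : ℝ) (n : ℕ) : ℂ := if n = 1 then 1 else if n = 0 then (c : ℂ) else 0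

lemma count_insert_update {N : ℕ} {U : Finset (Fin N)} {p : Fin N} (hp : p ∉ U) (e x : Fin 2)
    (s : Fin N → Fin 2) :
    count (insert p U) e (Function.update s p x) = (if x = e then 1 else 0) + count U e s := by
  unfold count
  rw [Finset.sum_insert hp, Function.update_self]
  congr 1
  refine Finset.sum_congr rfl fun q hq => ?_
  rw [Function.update_of_ne (ne_of_mem_of_not_mem hq hp)]

lemma count_add_count {N : ℕ} (U : Finset (Fin N)) (s : Fin N → Fin 2) :
    count U 0 s + count U 1 s = U.card := by
  unfold count
  rw [← Finset.sum_add_distrib, Finset.card_eq_sum_ones]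
  refine Finset.sum_congr rfl fun p _ => ?_
  obtain h | h : s p = 0 ∨ s p = 1 := by omega
  all_goals simp [h]

lemma normSq_postState {N : ℕ} (p : Fin N) (B : Pauli) (m : Fin 2) (ψ : QVec N)
    (h : outcomeProb p B m ψ ≠ 0) : normSq (postState p B m ψ) = 1 := by
  have h0 : 0 ≤ outcomeProb p B m ψ := Finset.sum_nonneg fun _ _ => by positivity
  have h1 : normSq (postState p B m ψ)
      = (outcomeProb p B m ψ)⁻¹ * normSq (projectQubit p (B.eigenvec m) ψ) := by
    simp only [normSq, postState, norm_mul, mul_pow, ← Finset.mul_sum]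
    congr 1
    rw [Complex.norm_real, Real.norm_eq_abs, sq_abs, inv_pow, Real.sq_sqrt h0]
  rw [h1]
  exact inv_mul_cancel₀ h

/-- Splitting a basis string into its entries at `i` and `j` and the rest. -/
def splitPair {N : ℕ} (i j : Fin N) (hij : i ≠ j) :
    (Fin N → Fin 2) ≃ (Fin 2 × Fin 2) × ({p : Fin N // p ≠ i ∧ p ≠ j} → Fin 2) where
  toFun s := ((s i, s j), fun p => s p)
  invFun t p := if hi : p = i then t.1.1 else if hj : p = j then t.1.2 else t.2 ⟨p, hi, hj⟩
  left_inv s := by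
    funext p
    by_cases hi : p = i
    · simp [hi]
    · by_cases hj : p = j
      · subst hj; simp [hi]
      · simp [hi, hj]
  right_inv t := by
    obtain ⟨⟨x, y⟩, f⟩ := t
    refine Prod.ext (Prod.ext (by simp) (by simp [hij.symm])) ?_
    funext p
    simp [p.2.1, p.2.2]

lemma normSq_pair_mul {N : ℕ} {i j : Fin N} (hij : i ≠ j) (χ : Fin 2 → Fin 2 → ℂ)
    (φ : ({p : Fin N // p ≠ i ∧ p ≠ j} → Fin 2) → ℂ) :
    normSq (fun s : Fin N → Fin 2 => χ (s i) (s j) * φ (fun p => s p))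
      = (∑ x, ∑ y, ‖χ x y‖ ^ 2) * normSq φ := by
  unfold normSq
  rw [← Fintype.sum_prod_type' (fun x y => ‖χ x y‖ ^ 2), Fintype.sum_mul_sum,
    ← Fintype.sum_prod_type' (f := fun (x : Fin 2 × Fin 2) t => ‖χ x.1 x.2‖ ^ 2 * ‖φ t‖ ^ 2)]
  refine Fintype.sum_equiv (splitPair i j hij) _ _ fun s => ?_
  simp [splitPair, mul_pow]

/-- A product vector has vanishing `2 × 2` determinant. One diagonal entry of `chi a e` is zero, so
its determinant is `-a²`. -/
lemma entangledPair_chi {a : ℝ} (ha : a ≠ 0) (e : Fin 2) : EntangledPair (chi a e) := by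
  rintro ⟨u, v, h⟩
  have h00 := h 0 0
  have h01 := h 0 1
  have h10 := h 1 0
  have h11 := h 1 1
  have hp : chi a e 0 0 * chi a e 1 1 = chi a e 0 1 * chi a e 1 0 := by
    rw [h00, h01, h10, h11]; ring
  have ha' : (a : ℂ) ≠ 0 := by exact_mod_cast ha
  obtain rfl | rfl : e = 0 ∨ e = 1 := by omega
  all_goals simp [chi, ha'] at hp

lemma sum_norm_chi {a : ℝ} (ha : 2 * a ^ 2 ≤ 1) (e : Fin 2) :
    ∑ x, ∑ y, ‖chi a e x y‖ ^ 2 = 1 := by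
  have hs : Real.sqrt (1 - 2 * a ^ 2) ^ 2 = 1 - 2 * a ^ 2 := Real.sq_sqrt (by linarith)
  obtain rfl | rfl : e = 0 ∨ e = 1 := by omega
  all_goals
    simp [chi, hs]
    ring

/-- The claim of the protocol about the state of the pair. -/
def PairGood {N : ℕ} (i j : Fin N) (ψ : QVec N) : Prop :=
  ∃ (a : ℝ) (e : Fin 2), a ≠ 0 ∧ 2 * a ^ 2 ≤ 1 ∧ PairInState ψ i j (chi a e) ∧
    EntangledPair (chi a e)

lemma exists_normalization (c : ℝ) :
    ∃ a r : ℝ, a ≠ 0 ∧ 2 * a ^ 2 ≤ 1 ∧ r * a = 1 ∧ r * Real.sqrt (1 - 2 * a ^ 2) = c := by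
  have hn : 0 < Real.sqrt (2 + c ^ 2) := Real.sqrt_pos.2 (by positivity)
  have hn2 : Real.sqrt (2 + c ^ 2) ^ 2 = 2 + c ^ 2 := Real.sq_sqrt (by positivity)
  set n := Real.sqrt (2 + c ^ 2)
  have hs : Real.sqrt (1 - 2 * (n⁻¹) ^ 2) = |c| / n := by
    rw [← Real.sqrt_sq (by positivity : (0 : ℝ) ≤ |c| / n)]
    congr 1
    rw [div_pow, sq_abs]
    field_simp
    linarith
  have h2 : 2 * (n⁻¹) ^ 2 ≤ 1 := by
    rw [inv_pow, hn2, mul_inv_le_iff₀ (by positivity)]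
    nlinarith [sq_nonneg c]
  -- The root is nonnegative, so a negative `c` is realized by a negative `a`; the sign goes into
  -- the factor `r`.
  rcases le_total 0 c with hc | hc
  · refine ⟨n⁻¹, n, by positivity, h2, by field_simp, ?_⟩
    rw [hs, abs_of_nonneg hc]
    field_simp
  · refine ⟨-n⁻¹, -n, by simp [hn.ne'], by rwa [neg_sq], by field_simp, ?_⟩
    rw [neg_sq, hs, abs_of_nonpos hc]
    field_simp

/-- The two kept qubits carry `|01⟩ + |10⟩ + c|ee⟩` with `e = 1 - f`. The rest vector `φ` absorbs
`h` and the scale `r`; its norm is 1 because both `ψ` and `chi` are normalized. -/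
lemma pairGood_of_wAmp {N : ℕ} {i j : Fin N} (hij : i ≠ j) {ψ h : QVec N} {c : ℝ} {f : Fin 2}
    (hψ : normSq ψ = 1) (hh : IndepOf {i, j} h)
    (hs : ∀ s, ψ s = h s * wAmp c (count {i, j} f s)) : PairGood i j ψ := by
  obtain ⟨a, r, ha, ha2, hra, hrs⟩ := exists_normalization c
  have hra' : (r : ℂ) * a = 1 := by exact_mod_cast hra
  have hrs' : (r : ℂ) * (Real.sqrt (1 - 2 * a ^ 2) : ℝ) = c := by exact_mod_cast hrs
  let φ : ({p : Fin N // p ≠ i ∧ p ≠ j} → Fin 2) → ℂ :=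
    fun t => r * h ((splitPair i j hij).symm ((0, 0), t))
  have hφ : ∀ s : Fin N → Fin 2, φ (fun p => s p) = r * h s := by
    intro s
    have h1 : (splitPair i j hij).symm ((0, 0), fun p => s p)
        = Function.update (Function.update s i 0) j 0 := by
      funext p
      by_cases hi : p = i
      · subst hi; simp [splitPair, hij]
      · by_cases hj : p = j
        · subst hj; simp [splitPair, hi]
        · simp [splitPair, hi, hj]
    simp only [φ]
    rw [h1, hh j (by simp), hh i (by simp)]
  have key : ∀ s, ψ s = chi a (1 - f) (s i) (s j) * φ (fun p => s p) := by
    intro s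
    rw [hs, hφ]
    have hc : count {i, j} f s = (if s i = f then 1 else 0) + (if s j = f then 1 else 0) := by
      unfold count; rw [Finset.sum_pair hij]
    rw [hc]
    have h2 : wAmp c ((if s i = f then 1 else 0) + (if s j = f then 1 else 0))
        = r * chi a (1 - f) (s i) (s j) := by
      generalize s i = x
      generalize s j = y
      fin_cases f <;> fin_cases x <;> fin_cases y <;> simp [wAmp, chi, hra', hrs']
    rw [h2]; ring
  refine ⟨a, 1 - f, ha, ha2, ⟨φ, ?_, key⟩, entangledPair_chi ha _⟩
  have := normSq_pair_mul hij (chi a (1 - f)) φ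
  rw [sum_norm_chi ha2, one_mul, ← funext key] at this
  rw [← this, hψ]

/-- The invariant is `W + c|0…0⟩` on the unmeasured qubits, with `f` playing the role of the
excitation. Both components of an `X` eigenvector are nonzero, which keeps the W part alive. -/
lemma xProtocol_everyBranch {N : ℕ} {i j : Fin N} (hij : i ≠ j) (f : Fin 2) (l : List (Fin N)) :
    ∀ (ψ h : QVec N) (c : ℝ), l.Nodup → i ∉ l → j ∉ l → normSq ψ = 1 →
      IndepOf (l.toFinset ∪ {i, j}) h →
      (∀ s, ψ s = h s * wAmp c (count (l.toFinset ∪ {i, j}) f s)) →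
      (xProtocol l).EveryBranch (PairGood i j) ψ := by
  induction l with
  | nil =>
    intro ψ h c _ _ _ hψ hh hs
    simp only [List.toFinset_nil, Finset.empty_union] at hh hs
    exact pairGood_of_wAmp hij hψ hh hs
  | cons p l ih =>
    intro ψ h c hl hi hj hψ hh hs m hm
    rw [List.nodup_cons] at hl
    simp only [List.mem_cons, not_or] at hi hj
    rw [List.toFinset_cons, Finset.insert_union] at hh hs
    have hp : p ∉ l.toFinset ∪ {i, j} := by
      simp [hl.1, Ne.symm hi.1, Ne.symm hj.1]
    set U := l.toFinset ∪ {i, j}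
    let v := Pauli.X.eigenvec m
    let w : Fin 2 → ℝ := fun x => (Real.sqrt 2)⁻¹ * (if m = 1 ∧ x = 1 then -1 else 1)
    have hv : ∀ x, v x = w x := by
      intro x; simp only [v, w, Pauli.eigenvec]; push_cast; split_ifs <;> simp
    have hw : ∀ x, w x ≠ 0 := by
      intro x; simp only [w]; split_ifs <;> simp
    -- Projection turns the amplitude at `n` excitations into `w (1 - f) * wAmp c n + w f * wAmp c
    -- (n + 1)`: this is `w (1 - f)` at `n = 1` and `w (1 - f) * c + w f` at `n = 0`. Dividing by `w
    -- (1 - f)` gives the new `c`.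
    refine ih _ (fun s => ((Real.sqrt (outcomeProb p .X m ψ))⁻¹ : ℝ) * (v (s p) * w (1 - f)) * h s)
      (c + w f / w (1 - f)) hl.2 hi.2 hj.2 (normSq_postState _ _ _ _ hm) ?_ ?_
    · intro q hq s x
      have hqp : p ≠ q := fun e => hp (e ▸ hq)
      simp only [Function.update_of_ne hqp, hh q (Finset.mem_insert_of_mem hq)]
    · intro s
      have h1 : ∑ x : Fin 2, conj (v x) * ψ (Function.update s p x)
          = w (1 - f) * h s * wAmp (c + w f / w (1 - f)) (count U f s) := by
        have h2 : ∀ x, conj (v x) * ψ (Function.update s p x)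
            = w x * (h s * wAmp c ((if x = f then 1 else 0) + count U f s)) := by
          intro x
          rw [hs, hv, Complex.conj_ofReal, count_insert_update hp,
            hh p (Finset.mem_insert_self _ _)]
        simp only [h2]
        have h3 : ∑ x, (w x : ℂ) * (h s * wAmp c ((if x = f then 1 else 0) + count U f s))
            = w (1 - f) * (h s * wAmp c (count U f s)) + w f * (h s * wAmp c (1 + count U f s)) := by
          fin_cases f <;> simp [Fin.sum_univ_two, add_comm]
        rw [h3]
        have hw' : (w (1 - f) : ℂ) ≠ 0 := by exact_mod_cast hw _
        generalize count U f s = n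
        rcases n with _ | _ | n
        · simp [wAmp]; field_simp
        · simp [wAmp]
        · simp [wAmp]
      simp only [postState, projectQubit]
      rw [h1]
      ring

lemma zxProtocol_everyBranch {N : ℕ} {i j : Fin N} (hij : i ≠ j) (l : List (Fin N)) :
    ∀ (k : ℕ) (ψ h : QVec N), 1 ≤ k → k ≤ l.length + 1 → l.Nodup → i ∉ l → j ∉ l →
      normSq ψ = 1 → IndepOf (l.toFinset ∪ {i, j}) h →
      (∀ s, ψ s = h s * if count (l.toFinset ∪ {i, j}) 1 s = k then 1 else 0) →
      (zxProtocol k l).EveryBranch (PairGood i j) ψ := by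
  have hone : ∀ n : ℕ, (if n = 1 then (1 : ℂ) else 0) = wAmp 0 n := by
    intro n; simp [wAmp]
  induction l with
  | nil =>
    intro k ψ h hk1 hk2 _ _ _ hψ hh hs
    obtain rfl : k = 1 := by simp at hk2; omega
    simp only [List.toFinset_nil, Finset.empty_union, hone] at hh hs
    exact pairGood_of_wAmp hij hψ hh hs
  | cons p l ih =>
    intro k ψ h hk1 hk2 hl hi hj hψ hh hs
    unfold zxProtocol
    split_ifs with hk
    · rcases hk with rfl | hk
      · simp only [hone] at hs
        exact xProtocol_everyBranch hij 1 _ ψ h 0 hl hi hj hψ hh hs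
      -- With `k = M - 1` there is exactly one zero among the `M` qubits: a W state whose excitation
      -- is `0`.
      · refine xProtocol_everyBranch hij 0 _ ψ h 0 hl hi hj hψ hh fun s => ?_
        have hcard : ((p :: l).toFinset ∪ {i, j}).card = l.length + 3 := by
          rw [Finset.card_union_of_disjoint, List.toFinset_card_of_nodup hl, Finset.card_pair hij,
            List.length_cons]
          rw [Finset.disjoint_right]
          intro q hq
          rw [List.mem_toFinset]
          rcases Finset.mem_insert.1 hq with rfl | hq
          · exact hi
          · rw [Finset.mem_singleton.1 hq]; exact hj
        have := count_add_count ((p :: l).toFinset ∪ {i, j}) s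
        rw [hs, ← hone]
        congr 2
        apply propext
        omega
    · rw [not_or] at hk
      intro m hm
      simp only [List.length_cons] at hk2
      rw [List.nodup_cons] at hl
      simp only [List.mem_cons, not_or] at hi hj
      rw [List.toFinset_cons, Finset.insert_union] at hh hs
      have hp : p ∉ l.toFinset ∪ {i, j} := by
        simp [hl.1, Ne.symm hi.1, Ne.symm hj.1]
      set U := l.toFinset ∪ {i, j}
      -- Here `2 ≤ k ≤ M - 2`, so `k - m` is not truncated and stays between `1` and `(M - 1) - 1`.
      have hm2 : m.val ≤ 1 := by omega
      refine ih _ _ (fun s => ((Real.sqrt (outcomeProb p .Z m ψ))⁻¹ : ℝ) *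
        (Pauli.Z.eigenvec m (s p)) * h s) (by omega) (by omega) hl.2 hi.2 hj.2
        (normSq_postState _ _ _ _ hm) ?_ ?_
      · intro q hq s x
        have hqp : p ≠ q := fun e => hp (e ▸ hq)
        simp only [Function.update_of_ne hqp, hh q (Finset.mem_insert_of_mem hq)]
      · intro s
        have h1 : ∑ x : Fin 2, conj (Pauli.Z.eigenvec m x) * ψ (Function.update s p x)
            = h s * if count U 1 s = k - m.val then 1 else 0 := by
          rw [Finset.sum_eq_single m]
          · rw [hs, count_insert_update hp, hh p (Finset.mem_insert_self _ _)]
            simp only [Pauli.eigenvec, if_true, map_one, one_mul]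
            congr 2
            apply propext
            obtain rfl | rfl : m = 0 ∨ m = 1 := by omega
            all_goals simp
            omega
          · intro x _ hx
            simp [Pauli.eigenvec, hx]
          · simp
        simp only [postState, projectQubit]
        rw [h1]
        ring

lemma card_filter_card_one (N k : ℕ) :
    (Finset.univ.filter fun s : Fin N → Fin 2 =>
      (Finset.univ.filter fun i => s i = 1).card = k).card = N.choose k := by
  have h : (Finset.powersetCard k (Finset.univ : Finset (Fin N))).card = N.choose k := by simp
  rw [← h]
  refine Finset.card_bij' (fun s _ => Finset.univ.filter fun i => s i = 1)
    (fun t _ i => if i ∈ t then 1 else 0) ?_ ?_ ?_ ?_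
  · intro s hs
    simpa [Finset.mem_powersetCard] using hs
  · intro t ht
    simpa [Finset.mem_powersetCard] using ht
  · intro s _
    funext i
    obtain h | h : s i = 0 ∨ s i = 1 := by omega
    all_goals simp [h]
  · intro t _
    ext i
    simp

lemma normSq_dicke {N k : ℕ} (hk : k ≤ N) : normSq (dicke N k) = 1 := by
  have hpos : (0 : ℝ) < N.choose k := by exact_mod_cast Nat.choose_pos hk
  have h : ∀ s : Fin N → Fin 2, ‖dicke N k s‖ ^ 2
      = if (Finset.univ.filter fun i => s i = 1).card = k then ((N.choose k : ℝ))⁻¹ else 0 := by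
    intro s
    unfold dicke
    split_ifs
    · rw [Complex.norm_real, Real.norm_eq_abs, sq_abs, inv_pow, Real.sq_sqrt hpos.le]
    · simp
  unfold normSq
  rw [Finset.sum_congr rfl fun s _ => h s, ← Finset.sum_filter, Finset.sum_const,
    card_filter_card_one, nsmul_eq_mul, mul_inv_cancel₀ hpos.ne']

lemma dicke_everyBranch {N k : ℕ} (hk1 : 1 ≤ k) (hkN : k ≤ N - 1) {i j : Fin N} (hij : i ≠ j)
    (l : List (Fin N)) (hl : l.Nodup) (hmem : ∀ p, p ∈ l ↔ p ≠ i ∧ p ≠ j) :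
    (zxProtocol k l).EveryBranch (PairGood i j) (dicke N k) := by
  have hU : l.toFinset ∪ {i, j} = Finset.univ := by
    ext p
    simp [hmem]
    tauto
  have hi : i ∉ l := by simp [hmem]
  have hj : j ∉ l := by simp [hmem]
  have hlen : l.length + 2 = N := by
    have hd : Disjoint l.toFinset {i, j} := by
      rw [Finset.disjoint_right]
      simp [hi, hj]
    have := Finset.card_union_of_disjoint hd
    rw [hU, List.toFinset_card_of_nodup hl, Finset.card_pair hij, Finset.card_univ,
      Fintype.card_fin] at this
    exact this.symm
  refine zxProtocol_everyBranch hij l k _ (fun _ => ((Real.sqrt (N.choose k : ℝ))⁻¹ : ℝ)) hk1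
    (by omega) hl hi hj (normSq_dicke (by omega)) (fun _ _ _ _ => rfl) fun s => ?_
  rw [hU]
  simp [dicke, count]

/-! ### Expectation values of local operators -/

lemma posSemidef_update {ι : Type} [DecidableEq ι] {d : ι → ℕ}
    {A : ∀ i, Matrix (Fin (d i)) (Fin (d i)) ℂ}
    (hA : ∀ i, (A i).PosSemidef) (i : ι) {X : Matrix (Fin (d i)) (Fin (d i)) ℂ}
    (hX : X.PosSemidef) (q : ι) : (Function.update A i X q).PosSemidef := by
  by_cases h : q = i
  · subst h; rwa [Function.update_self]
  · rw [Function.update_of_ne h]; exact hA q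

section PiTensor

variable {ι : Type} [Fintype ι] {d : ι → ℕ}

/-- The tensor product of operators indexed by an arbitrary finite type. -/
def piTensor (A : ∀ i, Matrix (Fin (d i)) (Fin (d i)) ℂ) :
    Matrix (∀ i, Fin (d i)) (∀ i, Fin (d i)) ℂ :=
  Matrix.of fun s t => ∏ i, A i (s i) (t i)

lemma piTensor_conjTranspose (A : ∀ i, Matrix (Fin (d i)) (Fin (d i)) ℂ) :
    (piTensor A).conjTranspose = piTensor fun i => (A i).conjTranspose := by
  ext s t
  simp [piTensor, Matrix.conjTranspose_apply]

variable [DecidableEq ι]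

lemma piTensor_mul (A B : ∀ i, Matrix (Fin (d i)) (Fin (d i)) ℂ) :
    piTensor A * piTensor B = piTensor fun i => A i * B i := by
  ext s t
  simp only [piTensor, Matrix.mul_apply, Matrix.of_apply, ← Finset.prod_mul_distrib]
  rw [Fintype.prod_sum]

lemma piTensor_update_add (A : ∀ i, Matrix (Fin (d i)) (Fin (d i)) ℂ) (i : ι)
    (X Y : Matrix (Fin (d i)) (Fin (d i)) ℂ) :
    piTensor (Function.update A i (X + Y))
      = piTensor (Function.update A i X) + piTensor (Function.update A i Y) := by
  have h : ∀ (Z : Matrix (Fin (d i)) (Fin (d i)) ℂ) (s t : ∀ i, Fin (d i)),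
      ∏ q, Function.update A i Z q (s q) (t q)
        = Z (s i) (t i) * ∏ q ∈ Finset.univ.erase i, A q (s q) (t q) := by
    intro Z s t
    rw [← Finset.mul_prod_erase _ _ (Finset.mem_univ i), Function.update_self]
    congr 1
    refine Finset.prod_congr rfl fun q hq => ?_
    rw [Function.update_of_ne (Finset.ne_of_mem_erase hq)]
  ext s t
  simp only [piTensor, Matrix.of_apply, Matrix.add_apply, h, add_mul]

section

open scoped MatrixOrder

lemma exists_eq_conjTranspose_mul_self {κ : Type*} [Fintype κ] [DecidableEq κ] {A : Matrix κ κ ℂ}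
    (hA : A.PosSemidef) : ∃ B : Matrix κ κ ℂ, A = B.conjTranspose * B :=
  CStarAlgebra.nonneg_iff_eq_star_mul_self.mp hA.nonneg

end

lemma posSemidef_piTensor {A : ∀ i, Matrix (Fin (d i)) (Fin (d i)) ℂ}
    (hA : ∀ i, (A i).PosSemidef) : (piTensor A).PosSemidef := by
  choose B hB using fun i => exists_eq_conjTranspose_mul_self (hA i)
  have h : piTensor A = (piTensor B).conjTranspose * piTensor B := by
    rw [piTensor_conjTranspose, piTensor_mul, ← funext hB]
  rw [h]
  exact Matrix.posSemidef_conjTranspose_mul_self _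

lemma trace_mul_nonneg {κ : Type*} [Fintype κ] [DecidableEq κ] {A B : Matrix κ κ ℂ}
    (hA : A.PosSemidef) (hB : B.PosSemidef) : 0 ≤ (A * B).trace := by
  obtain ⟨C, rfl⟩ := exists_eq_conjTranspose_mul_self hB
  rw [← Matrix.mul_assoc, Matrix.trace_mul_comm, ← Matrix.mul_assoc]
  exact (hA.mul_mul_conjTranspose_same C).trace_nonneg

/-- The expectation value of a product of local operators. -/
noncomputable def expect (σ : Matrix (∀ i, Fin (d i)) (∀ i, Fin (d i)) ℂ)
    (A : ∀ i, Matrix (Fin (d i)) (Fin (d i)) ℂ) : ℝ :=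
  (σ * piTensor A).trace.re

lemma trace_mul_piTensor {σ : Matrix (∀ i, Fin (d i)) (∀ i, Fin (d i)) ℂ} (hσ : σ.PosSemidef)
    {A : ∀ i, Matrix (Fin (d i)) (Fin (d i)) ℂ} (hA : ∀ i, (A i).PosSemidef) :
    (σ * piTensor A).trace = expect σ A :=
  (Complex.eq_re_of_ofReal_le (r := 0)
    (by simpa using trace_mul_nonneg hσ (posSemidef_piTensor hA)))

lemma expect_nonneg {σ : Matrix (∀ i, Fin (d i)) (∀ i, Fin (d i)) ℂ} (hσ : σ.PosSemidef)
    {A : ∀ i, Matrix (Fin (d i)) (Fin (d i)) ℂ} (hA : ∀ i, (A i).PosSemidef) :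
    0 ≤ expect σ A :=
  (Complex.le_def.1 (trace_mul_nonneg hσ (posSemidef_piTensor hA))).1

lemma expect_update_add (σ : Matrix (∀ i, Fin (d i)) (∀ i, Fin (d i)) ℂ)
    (A : ∀ i, Matrix (Fin (d i)) (Fin (d i)) ℂ) (i : ι)
    (X Y : Matrix (Fin (d i)) (Fin (d i)) ℂ) :
    expect σ (Function.update A i X) + expect σ (Function.update A i Y)
      = expect σ (Function.update A i (X + Y)) := by
  simp [expect, piTensor_update_add, Matrix.mul_add]

/-- The conditional weights of two binary measurements on one party: an outcome of the first
measurement is at most as probable as all outcomes of the second one together. -/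
lemma expect_update_le {σ : Matrix (∀ i, Fin (d i)) (∀ i, Fin (d i)) ℂ} (hσ : σ.PosSemidef)
    {A : ∀ i, Matrix (Fin (d i)) (Fin (d i)) ℂ} (hA : ∀ i, (A i).PosSemidef) (i : ι)
    {F G : Fin 2 → Matrix (Fin (d i)) (Fin (d i)) ℂ} (hF : IsPOVM F) (hG : IsPOVM G) :
    expect σ (Function.update A i (F 0))
      ≤ expect σ (Function.update A i (G 0)) + expect σ (Function.update A i (G 1)) := by
  have h1 := hF.2
  have h2 := hG.2
  rw [Fin.sum_univ_two] at h1 h2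
  rw [expect_update_add, h2, ← h1, ← expect_update_add]
  exact le_add_of_nonneg_right (expect_nonneg hσ (posSemidef_update hA i (hF.1 1)))

end PiTensor

/-- Basis strings split into their parts on `g` and off `g`, and both factors of the integrand split
with them. -/
lemma trace_groupProduct {N : ℕ} {d : Fin N → ℕ} (g : Set (Fin N)) [DecidablePred (· ∈ g)]
    (σ : Matrix (∀ i : {i // i ∈ g}, Fin (d i)) (∀ i : {i // i ∈ g}, Fin (d i)) ℂ)
    (τ : Matrix (∀ i : {i // i ∉ g}, Fin (d i)) (∀ i : {i // i ∉ g}, Fin (d i)) ℂ)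
    (A : ∀ i, Matrix (Fin (d i)) (Fin (d i)) ℂ) :
    (groupProduct g σ τ * tensorOp A).trace
      = (σ * piTensor fun i : {i // i ∈ g} => A i).trace
        * (τ * piTensor fun i : {i // i ∉ g} => A i).trace := by
  let e := Equiv.piEquivPiSubtypeProd (· ∈ g) fun i => Fin (d i)
  simp only [Matrix.trace, Matrix.diag, Matrix.mul_apply]
  rw [Fintype.sum_mul_sum]
  refine (Fintype.sum_equiv e _ _ fun s => ?_).trans (Fintype.sum_prod_type' _)
  rw [Fintype.sum_mul_sum]
  refine (Fintype.sum_equiv e _ _ fun t => ?_).trans (Fintype.sum_prod_type' _)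
  simp only [groupProduct, tensorOp, piTensor, Matrix.of_apply,
    ← Fintype.prod_subtype_mul_prod_subtype (· ∈ g) fun i => A i (t i) (s i)]
  simp only [e, Equiv.piEquivPiSubtypeProd, Equiv.coe_fn_mk]
  ring

/-! ### A Hardy-type Bell expression for genuine multipartite entanglement -/

/-- The string with entries `u` at `i`, `v` at `j`, and `0` elsewhere. -/
def pairString {N : ℕ} (i j : Fin N) (u v : Fin 2) : Fin N → Fin 2 :=
  Function.update (Function.update 0 i u) j v

lemma pairString_comm {N : ℕ} {i j : Fin N} (hij : i ≠ j) (u v : Fin 2) :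
    pairString i j u v = pairString j i v u := by
  unfold pairString
  rw [Function.update_comm hij]

lemma pairString_zero {N : ℕ} {i j : Fin N} (hij : i ≠ j) (u : Fin 2) :
    pairString i j u 0 = Function.update (0 : Fin N → Fin 2) i u := by
  rw [pairString, Function.update_eq_self_iff]
  simp [hij.symm]

/-- The coefficients that pick out a single probability. -/
def indicator {N : ℕ} (x₀ a₀ : Fin N → Fin 2) (x a : Fin N → Fin 2) : ℝ :=
  if x = x₀ ∧ a = a₀ then 1 else 0

/-- The Hardy-type Bell expression for the pairs `{i, j}` with `i` fixed. -/
noncomputable def hardyBell {N : ℕ} (i : Fin N) : (Fin N → Fin 2) → (Fin N → Fin 2) → ℝ :=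
  indicator 0 0 - indicator (Function.update 0 i 1) 0
    - ∑ j ∈ Finset.univ.erase i, (indicator (pairString i j 0 1) 0
      + indicator (pairString i j 1 1) (pairString i j 1 1))

lemma bellValue_hardyBell {N : ℕ} {d : Fin N → ℕ} (i : Fin N)
    (ρ : Matrix (∀ i, Fin (d i)) (∀ i, Fin (d i)) ℂ) (E : LocalMeasurements d 2 2) :
    bellValue (hardyBell i) ρ E = bornProb ρ E 0 0 - bornProb ρ E (Function.update 0 i 1) 0
      - ∑ j ∈ Finset.univ.erase i, (bornProb ρ E (pairString i j 0 1) 0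
        + bornProb ρ E (pairString i j 1 1) (pairString i j 1 1)) := by
  let L : ((Fin N → Fin 2) → (Fin N → Fin 2) → ℝ) →ₗ[ℝ] ℝ :=
    { toFun := fun B => bellValue B ρ E
      map_add' := fun B C => by simp [bellValue, add_mul, Finset.sum_add_distrib]
      map_smul' := fun c B => by simp [bellValue, Finset.mul_sum, mul_assoc] }
  have hL : ∀ x₀ a₀, L (indicator x₀ a₀) = bornProb ρ E x₀ a₀ := by
    intro x₀ a₀
    simp [L, bellValue, indicator, ite_and]
  change L (hardyBell i) = _
  simp only [hardyBell, map_sub, map_sum, map_add, hL]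

/-- The Clauser-Horne inequality for products of subnormalized weights. -/
lemma clauser_horne {p q u₀ u₁ v₀ v₁ : ℝ} (hq : 0 ≤ q)
    (hu₀ : 0 ≤ u₀) (hu₁ : 0 ≤ u₁) (hv₀ : 0 ≤ v₀) (hv₁ : 0 ≤ v₁) (hp : 0 ≤ p)
    (hpu : p ≤ u₀ + u₁) (hqv : q ≤ v₀ + v₁) :
    p * q ≤ u₀ * q + p * v₀ + u₁ * v₁ := by
  rcases le_total p u₀ with h | h
  · nlinarith [mul_nonneg hp hv₀, mul_nonneg hu₁ hv₁, mul_le_mul_of_nonneg_right h hq]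
  rcases le_total q v₀ with h' | h'
  · nlinarith [mul_nonneg hu₀ hq, mul_nonneg hu₁ hv₁, mul_le_mul_of_nonneg_left h' hp]
  -- When both differences are nonnegative, they are bounded by `u₁` and `v₁`; expanding the product
  -- leaves a spare `u₀ * v₀ ≥ 0`.
  · have : (p - u₀) * (q - v₀) ≤ u₁ * v₁ :=
      mul_le_mul (by linarith) (by linarith) (by linarith) hu₁
    nlinarith [mul_nonneg hu₀ hv₀]

/-- Each probability factors into a weight of `σ` and a weight of `τ`, where the parties other than
`i`, `j` contribute fixed effects. These weights are subnormalized, and completeness of the POVMs of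
`i` and `j` supplies the hypotheses of `clauser_horne`. -/
lemma bornProb_pair_le {N : ℕ} {d : Fin N → ℕ} (g : Set (Fin N)) [DecidablePred (· ∈ g)]
    {σ : Matrix (∀ i : {i // i ∈ g}, Fin (d i)) (∀ i : {i // i ∈ g}, Fin (d i)) ℂ}
    {τ : Matrix (∀ i : {i // i ∉ g}, Fin (d i)) (∀ i : {i // i ∉ g}, Fin (d i)) ℂ}
    (hσ : σ.PosSemidef) (hτ : τ.PosSemidef) (E : LocalMeasurements d 2 2)
    {i j : Fin N} (hi : i ∈ g) (hj : j ∉ g) :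
    bornProb (groupProduct g σ τ) E 0 0
      ≤ bornProb (groupProduct g σ τ) E (pairString i j 1 0) 0
        + bornProb (groupProduct g σ τ) E (pairString i j 0 1) 0
        + bornProb (groupProduct g σ τ) E (pairString i j 1 1) (pairString i j 1 1) := by
  have hij : i ≠ j := fun h => hj (h ▸ hi)
  have hE : ∀ q x a, (E.effect q x a).PosSemidef := fun q x => (E.isPOVM q x).1
  let A : ∀ q : {q // q ∈ g}, Matrix (Fin (d q)) (Fin (d q)) ℂ := fun q => E.effect q 0 0
  let B : ∀ q : {q // q ∉ g}, Matrix (Fin (d q)) (Fin (d q)) ℂ := fun q => E.effect q 0 0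
  let P : Fin 2 → Fin 2 → ℝ := fun u a =>
    expect σ (Function.update A ⟨i, hi⟩ (E.effect i u a))
  let Q : Fin 2 → Fin 2 → ℝ := fun v b =>
    expect τ (Function.update B ⟨j, hj⟩ (E.effect j v b))
  have hA : ∀ u a q, (Function.update A ⟨i, hi⟩ (E.effect i u a) q).PosSemidef :=
    fun u a => posSemidef_update (A := A) (fun q => hE q 0 0) ⟨i, hi⟩ (hE i u a)
  have hB : ∀ v b q, (Function.update B ⟨j, hj⟩ (E.effect j v b) q).PosSemidef :=
    fun v b => posSemidef_update (A := B) (fun q => hE q 0 0) ⟨j, hj⟩ (hE j v b)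
  have key : ∀ u v a b, bornProb (groupProduct g σ τ) E (pairString i j u v) (pairString i j a b)
      = P u a * Q v b := by
    intro u v a b
    have h1 : (fun q : {q // q ∈ g} =>
        E.effect q (pairString i j u v q) (pairString i j a b q))
          = Function.update A ⟨i, hi⟩ (E.effect i u a) := by
      funext ⟨q, hq⟩
      have hqj : q ≠ j := fun h => hj (h ▸ hq)
      by_cases h : q = i
      · subst h; simp [pairString, hqj]
      · rw [Function.update_of_ne (by simpa using h)]
        simp [pairString, hqj, h, A]
    have h2 : (fun q : {q // q ∉ g} =>
        E.effect q (pairString i j u v q) (pairString i j a b q))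
          = Function.update B ⟨j, hj⟩ (E.effect j v b) := by
      funext ⟨q, hq⟩
      have hqi : q ≠ i := fun h => hq (h ▸ hi)
      by_cases h : q = j
      · subst h; simp [pairString]
      · rw [Function.update_of_ne (by simpa using h)]
        simp [pairString, hqi, h, B]
    rw [bornProb, trace_groupProduct, h1, h2, trace_mul_piTensor hσ (hA u a),
      trace_mul_piTensor hτ (hB v b), ← Complex.ofReal_mul, Complex.ofReal_re]
  have h00 : pairString i j 0 0 = 0 := by rw [pairString_zero hij]; simp
  have k1 := key 0 0 0 0
  have k2 := key 1 0 0 0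
  have k3 := key 0 1 0 0
  rw [h00] at k1 k2 k3
  rw [k1, k2, k3, key]
  exact clauser_horne (expect_nonneg hτ (hB 0 0)) (expect_nonneg hσ (hA 1 0))
    (expect_nonneg hσ (hA 1 1)) (expect_nonneg hτ (hB 1 0)) (expect_nonneg hτ (hB 1 1))
    (expect_nonneg hσ (hA 0 0))
    (expect_update_le hσ (fun q => hE q 0 0) ⟨i, hi⟩ (E.isPOVM i 0) (E.isPOVM i 1))
    (expect_update_le hτ (fun q => hE q 0 0) ⟨j, hj⟩ (E.isPOVM j 0) (E.isPOVM j 1))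

lemma bornProb_groupProduct_nonneg {N : ℕ} {d : Fin N → ℕ} (g : Set (Fin N))
    [DecidablePred (· ∈ g)]
    {σ : Matrix (∀ i : {i // i ∈ g}, Fin (d i)) (∀ i : {i // i ∈ g}, Fin (d i)) ℂ}
    {τ : Matrix (∀ i : {i // i ∉ g}, Fin (d i)) (∀ i : {i // i ∉ g}, Fin (d i)) ℂ}
    (hσ : σ.PosSemidef) (hτ : τ.PosSemidef) {m n : ℕ} (E : LocalMeasurements d m n)
    (x : Fin N → Fin m) (a : Fin N → Fin n) : 0 ≤ bornProb (groupProduct g σ τ) E x a := by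
  have hE : ∀ q x a, (E.effect q x a).PosSemidef := fun q x => (E.isPOVM q x).1
  rw [bornProb, trace_groupProduct, trace_mul_piTensor hσ fun _ => hE _ _ _,
    trace_mul_piTensor hτ fun _ => hE _ _ _, ← Complex.ofReal_mul, Complex.ofReal_re]
  exact mul_nonneg (expect_nonneg hσ fun _ => hE _ _ _) (expect_nonneg hτ fun _ => hE _ _ _)

open Classical in
lemma bellValue_hardyBell_groupProduct {N : ℕ} {d : Fin N → ℕ} (g : Set (Fin N))
    (hg : g.Nonempty) (hgc : gᶜ.Nonempty)
    {σ : Matrix (∀ i : {i // i ∈ g}, Fin (d i)) (∀ i : {i // i ∈ g}, Fin (d i)) ℂ}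
    {τ : Matrix (∀ i : {i // i ∉ g}, Fin (d i)) (∀ i : {i // i ∉ g}, Fin (d i)) ℂ}
    (hσ : σ.PosSemidef) (hτ : τ.PosSemidef) (E : LocalMeasurements d 2 2) (i : Fin N) :
    bellValue (hardyBell i) (groupProduct g σ τ) E ≤ 0 := by
  rw [bellValue_hardyBell]
  set p := bornProb (groupProduct g σ τ) E with hp
  have hnn : ∀ x a, 0 ≤ p x a := bornProb_groupProduct_nonneg g hσ hτ E
  have main : ∀ j, i ≠ j →
      p 0 0 ≤ p (pairString i j 1 0) 0 + p (pairString i j 0 1) 0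
        + p (pairString i j 1 1) (pairString i j 1 1) →
      p 0 0 - p (Function.update 0 i 1) 0 - ∑ j ∈ Finset.univ.erase i,
        (p (pairString i j 0 1) 0 + p (pairString i j 1 1) (pairString i j 1 1)) ≤ 0 := by
    intro j hij h
    have h1 := Finset.single_le_sum
      (f := fun j => p (pairString i j 0 1) 0 + p (pairString i j 1 1) (pairString i j 1 1))
      (fun j _ => add_nonneg (hnn _ _) (hnn _ _))
      (Finset.mem_erase.2 ⟨hij.symm, Finset.mem_univ j⟩)
    rw [pairString_zero hij] at h
    linarith
  by_cases hi : i ∈ g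
  · obtain ⟨j, hj⟩ := hgc
    exact main j (fun h => hj (h ▸ hi)) (bornProb_pair_le g hσ hτ E hi hj)
  -- If `i` lies outside `g`, the pair is taken in the order `j, i`; the inequality is symmetric
  -- under this exchange.
  · obtain ⟨j, hj⟩ := hg
    have hij : i ≠ j := fun h => hi (h ▸ hj)
    refine main j hij ?_
    have := bornProb_pair_le g hσ hτ E hj hi
    rw [← hp] at this
    rw [pairString_comm hij, pairString_comm hij, pairString_comm hij 1 1]
    linarith

lemma bellValue_hardyBell_le {N : ℕ} {d : Fin N → ℕ}
    {ρ : Matrix (∀ i, Fin (d i)) (∀ i, Fin (d i)) ℂ} (hρ : IsBiseparable ρ)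
    (E : LocalMeasurements d 2 2) (i : Fin N) : bellValue (hardyBell i) ρ E ≤ 0 := by
  have hlin : IsLinearMap ℝ
      fun ρ : Matrix (∀ i, Fin (d i)) (∀ i, Fin (d i)) ℂ => bellValue (hardyBell i) ρ E :=
    { map_add := fun ρ τ => by
        simp [bellValue, bornProb, Matrix.add_mul, mul_add, Finset.sum_add_distrib]
      map_smul := fun c ρ => by
        simp [bellValue, bornProb, Finset.mul_sum, mul_left_comm] }
  refine convexHull_min ?_ (convex_halfSpace_le hlin 0) hρ
  rintro _ ⟨g, hg, hgc, σ, τ, hσ, hτ, rfl⟩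
  exact bellValue_hardyBell_groupProduct g hg hgc hσ.1 hτ.1 E i

/-! ### Real projective measurements on Dicke states -/

/-- The vector itself for outcome `0`, and the orthogonal vector for outcome `1`. -/
def rot (a : Fin 2) (v : Fin 2 → ℝ) : Fin 2 → ℝ := if a = 0 then v else ![-v 1, v 0]

lemma isPOVM_rot {v : Fin 2 → ℝ} (hv : 0 < v 0 ^ 2 + v 1 ^ 2) :
    IsPOVM fun a : Fin 2 => (((v 0 ^ 2 + v 1 ^ 2)⁻¹ : ℝ) : ℂ) •
      Matrix.vecMulVec (fun x => (rot a v x : ℂ)) (star fun x => (rot a v x : ℂ)) := by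
  refine ⟨fun a => (Matrix.posSemidef_vecMulVec_self_star _).smul ?_, ?_⟩
  · exact_mod_cast (inv_pos.2 hv).le
  · have h : ((v 0 : ℂ) ^ 2 + (v 1 : ℂ) ^ 2) ≠ 0 := by exact_mod_cast hv.ne'
    ext x y
    fin_cases x <;> fin_cases y <;>
      simp [rot, Matrix.vecMulVec_apply, Fin.sum_univ_two] <;> field_simp <;> ring

/-- Projective qubit measurements in the real orthogonal bases that contain the vectors `w i x`. -/
noncomputable def realMeasurements {N : ℕ} (w : Fin N → Fin 2 → Fin 2 → ℝ)
    (hw : ∀ i x, 0 < w i x 0 ^ 2 + w i x 1 ^ 2) :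
    LocalMeasurements (fun _ : Fin N => 2) 2 2 where
  effect i x a := (((w i x 0 ^ 2 + w i x 1 ^ 2)⁻¹ : ℝ) : ℂ) •
    Matrix.vecMulVec (fun y => (rot a (w i x) y : ℂ)) (star fun y => (rot a (w i x) y : ℂ))
  isPOVM i x := isPOVM_rot (hw i x)

open Polynomial in
/-- The overlap of a product vector with the unnormalized Dicke vector with `k` excitations. -/
noncomputable def overlap {N : ℕ} (k : ℕ) (v : Fin N → Fin 2 → ℝ) : ℝ :=
  (∏ i, (C (v i 0) + C (v i 1) * X)).coeff k

-- Each party contributes `v 0 + v 1 * X`, so the exponent of `X` in the expanded product counts the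
-- ones.
open Polynomial in
lemma overlap_eq_sum {N : ℕ} (k : ℕ) (v : Fin N → Fin 2 → ℝ) :
    overlap k v = ∑ s : Fin N → Fin 2,
      if (Finset.univ.filter fun i => s i = 1).card = k then ∏ i, v i (s i) else 0 := by
  have h1 : ∀ i, C (v i 0) + C (v i 1) * X = ∑ x : Fin 2, C (v i x) * X ^ x.val := by
    intro i; simp [Fin.sum_univ_two]
  have h2 : ∀ s : Fin N → Fin 2,
      ∑ i, (s i).val = (Finset.univ.filter fun i => s i = 1).card := by
    intro s
    rw [Finset.card_filter]
    refine Finset.sum_congr rfl fun i _ => ?_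
    obtain h | h : s i = 0 ∨ s i = 1 := by omega
    all_goals simp [h]
  unfold overlap
  rw [Finset.prod_congr rfl fun i _ => h1 i, Fintype.prod_sum, finsetSum_coeff]
  refine Finset.sum_congr rfl fun s _ => ?_
  rw [Finset.prod_mul_distrib, Finset.prod_pow_eq_pow_sum, h2, ← map_prod, coeff_C_mul_X_pow]
  simp only [eq_comm]

lemma bornProb_dicke {N k : ℕ} (w : Fin N → Fin 2 → Fin 2 → ℝ)
    (hw : ∀ i x, 0 < w i x 0 ^ 2 + w i x 1 ^ 2) (x a : Fin N → Fin 2) :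
    bornProb (Matrix.vecMulVec (dicke N k) (star (dicke N k))) (realMeasurements w hw) x a
      = (N.choose k : ℝ)⁻¹ * (∏ i, (w i (x i) 0 ^ 2 + w i (x i) 1 ^ 2)⁻¹)
        * overlap k (fun i => rot (a i) (w i (x i))) ^ 2 := by
  set v : Fin N → Fin 2 → ℝ := fun i => rot (a i) (w i (x i)) with hv
  set c : ℝ := (Real.sqrt (N.choose k : ℝ))⁻¹ with hc
  have hc2 : c ^ 2 = (N.choose k : ℝ)⁻¹ := by
    rw [hc, inv_pow, Real.sq_sqrt (Nat.cast_nonneg _)]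
  let D : (Fin N → Fin 2) → ℝ := fun s =>
    if (Finset.univ.filter fun i => s i = 1).card = k then c else 0
  have hD : ∀ s, dicke N k s = D s := by
    intro s; simp only [dicke, D, hc]; split_ifs <;> simp
  have hsum : ∑ s, D s * ∏ i, v i (s i) = c * overlap k v := by
    rw [overlap_eq_sum, Finset.mul_sum]
    refine Finset.sum_congr rfl fun s _ => ?_
    simp only [D]; split_ifs <;> simp
  set n : ℝ := ∏ i, (w i (x i) 0 ^ 2 + w i (x i) 1 ^ 2)⁻¹ with hn
  have key : (Matrix.vecMulVec (dicke N k) (star (dicke N k)) *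
      tensorOp fun i => (realMeasurements w hw).effect i (x i) (a i)).trace
        = ((n * ((∑ s, D s * ∏ i, v i (s i)) * ∑ s, D s * ∏ i, v i (s i)) : ℝ) : ℂ) := by
    simp only [Matrix.trace, Matrix.diag, Matrix.mul_apply]
    rw [Finset.sum_mul_sum, Finset.mul_sum]
    push_cast
    refine Finset.sum_congr rfl fun s _ => ?_
    rw [Finset.mul_sum]
    refine Finset.sum_congr rfl fun t _ => ?_
    have ht : tensorOp (fun i => (realMeasurements w hw).effect i (x i) (a i)) t s
        = n * ((∏ i, (v i (t i) : ℂ)) * ∏ i, (v i (s i) : ℂ)) := by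
      simp only [tensorOp, realMeasurements, Matrix.of_apply, Matrix.smul_apply,
        Matrix.vecMulVec_apply, smul_eq_mul, Finset.prod_mul_distrib, hn, Complex.ofReal_prod, hv,
        Pi.star_apply, RCLike.star_def, Complex.conj_ofReal]
    rw [ht]
    simp only [Matrix.vecMulVec_apply, Pi.star_apply, hD, RCLike.star_def, Complex.conj_ofReal]
    ring
  rw [bornProb, key, Complex.ofReal_re, hsum, ← hc2]
  ring

/-! ### Violation of the Hardy-type inequality by Dicke states -/

/-- The bilinear form of the symmetric matrix `!![A, B; B, C]`. -/
def symForm (A B C : ℝ) (y z : Fin 2 → ℝ) : ℝ :=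
  y 0 * z 0 * A + (y 0 * z 1 + y 1 * z 0) * B + y 1 * z 1 * C

open Polynomial in
lemma coeff_one_add_mul_X_pow (t : ℝ) (n k : ℕ) :
    ((1 + C t * X : ℝ[X]) ^ n).coeff k = n.choose k * t ^ k := by
  have h : (1 + C t * X : ℝ[X]) ^ n = ((1 + X) ^ n).comp (C t * X) := by simp
  rw [h, comp_C_mul_X_coeff, coeff_one_add_X_pow]

-- The product is `(1 + tX)^n` times the two linear factors of `i` and `j`, read off at `X^(k+1)`.
-- For `k = 0` the last entry must be 0, whereas the truncated `k - 1` would give 1.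
open Polynomial in
lemma overlap_pair {n k : ℕ} {i j : Fin (n + 2)} (hij : i ≠ j) (t : ℝ)
    {v : Fin (n + 2) → Fin 2 → ℝ} (hv : ∀ q, q ≠ i → q ≠ j → v q = ![1, t]) :
    overlap (k + 1) v = symForm (n.choose (k + 1) * t ^ (k + 1)) (n.choose k * t ^ k)
      (if k = 0 then 0 else n.choose (k - 1) * t ^ (k - 1)) (v i) (v j) := by
  have hcard : ((Finset.univ.erase i).erase j).card = n := by
    rw [Finset.card_erase_of_mem (by simp [hij.symm]), Finset.card_erase_of_mem (by simp)]
    simp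
  have hprod : ∏ q, (C (v q 0) + C (v q 1) * X)
      = C (v i 0 * v j 0) * (1 + C t * X) ^ n
        + C (v i 0 * v j 1 + v i 1 * v j 0) * ((1 + C t * X) ^ n * X)
        + C (v i 1 * v j 1) * ((1 + C t * X) ^ n * X * X) := by
    rw [← Finset.mul_prod_erase _ _ (Finset.mem_univ i),
      ← Finset.mul_prod_erase (Finset.univ.erase i) _ (by simp [hij.symm] : j ∈ _),
      Finset.prod_congr rfl (g := fun _ => 1 + C t * X), Finset.prod_const, hcard]
    · simp only [map_add, map_mul]
      ring
    · intro q hq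
      simp only [Finset.mem_erase] at hq
      rw [hv q hq.2.1 hq.1]
      simp
  rw [overlap, hprod]
  simp only [coeff_add, coeff_C_mul, coeff_mul_X, coeff_one_add_mul_X_pow, symForm]
  rcases k with _ | k
  · simp [mul_coeff_zero]
  · simp [coeff_mul_X, coeff_one_add_mul_X_pow]

/-- The measurement vectors: `p`, `q` for party `i`, and `(1, t)`, `r` for the other parties. -/
def starVectors {N : ℕ} (i : Fin N) (t : ℝ) (p q r : Fin 2 → ℝ) :
    Fin N → Fin 2 → Fin 2 → ℝ :=
  fun j x => if j = i then (if x = 0 then p else q) else (if x = 0 then ![1, t] else r)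

lemma starVectors_pos {N : ℕ} (i : Fin N) (t : ℝ) {p q r : Fin 2 → ℝ}
    (hp : 0 < p 0 ^ 2 + p 1 ^ 2) (hq : 0 < q 0 ^ 2 + q 1 ^ 2) (hr : 0 < r 0 ^ 2 + r 1 ^ 2)
    (j : Fin N) (x : Fin 2) :
    0 < starVectors i t p q r j x 0 ^ 2 + starVectors i t p q r j x 1 ^ 2 := by
  unfold starVectors
  split_ifs
  · exact hp
  · exact hq
  · simp only [Matrix.cons_val_zero, Matrix.cons_val_one]; positivity
  · exact hr

lemma bornProb_starVectors {n k : ℕ} {i j : Fin (n + 2)} (hij : i ≠ j) {t : ℝ}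
    {p q r : Fin 2 → ℝ} (hw : ∀ j x, 0 < starVectors i t p q r j x 0 ^ 2
      + starVectors i t p q r j x 1 ^ 2) (u v a b : Fin 2) :
    bornProb (Matrix.vecMulVec (dicke (n + 2) (k + 1)) (star (dicke (n + 2) (k + 1))))
      (realMeasurements (starVectors i t p q r) hw) (pairString i j u v) (pairString i j a b)
      = ((n + 2).choose (k + 1) : ℝ)⁻¹ *
        (∏ l, (starVectors i t p q r l (pairString i j u v l) 0 ^ 2
          + starVectors i t p q r l (pairString i j u v l) 1 ^ 2)⁻¹) *
        symForm (n.choose (k + 1) * t ^ (k + 1)) (n.choose k * t ^ k)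
          (if k = 0 then 0 else n.choose (k - 1) * t ^ (k - 1))
          (rot a (if u = 0 then p else q)) (rot b (if v = 0 then ![1, t] else r)) ^ 2 := by
  rw [bornProb_dicke, overlap_pair hij t]
  · simp [pairString, starVectors, hij, hij.symm]
  · intro l hi hj
    simp [pairString, starVectors, hi, hj, rot]

/-- The vectors of a Hardy paradox for a real symmetric two-qubit vector, with `(1, t)` as one of
the vectors. -/
lemma exists_hardy {A B C t : ℝ} (hdet : A * C ≠ B ^ 2) (hAC : A + C ≠ 0)
    (ht : B * (1 - t ^ 2) + (C - A) * t ≠ 0) :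
    ∃ p q r : Fin 2 → ℝ, 0 < p 0 ^ 2 + p 1 ^ 2 ∧ 0 < q 0 ^ 2 + q 1 ^ 2 ∧ 0 < r 0 ^ 2 + r 1 ^ 2 ∧
      symForm A B C p ![1, t] ≠ 0 ∧ symForm A B C q ![1, t] = 0 ∧ symForm A B C p r = 0 ∧
      symForm A B C (rot 1 q) (rot 1 r) = 0 := by
  have hpos : ∀ v : Fin 2 → ℝ, (v 0 = 0 → v 1 ≠ 0) → 0 < v 0 ^ 2 + v 1 ^ 2 := by
    intro v hv
    by_cases h : v 0 = 0
    · have := hv h; positivity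
    · positivity
  -- `u` is the image of `(1, t)` under the matrix, `w` its image under the cube of the matrix
  set u₀ := A + B * t with hu₀
  set u₁ := B + C * t with hu₁
  set w₀ := A * (A * u₀ + B * u₁) + B * (B * u₀ + C * u₁) with hw₀
  set w₁ := B * (A * u₀ + B * u₁) + C * (B * u₀ + C * u₁) with hw₁
  have hne : w₀ * u₁ - w₁ * u₀ ≠ 0 := by
    have : w₀ * u₁ - w₁ * u₀
        = -((A * C - B ^ 2) * ((A + C) * (B * (1 - t ^ 2) + (C - A) * t))) := by
      rw [hw₀, hw₁, hu₀, hu₁]; ring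
    rw [this]
    exact neg_ne_zero.2 (mul_ne_zero (sub_ne_zero.2 hdet) (mul_ne_zero hAC ht))
  -- Let `M` be the matrix and `e = (1, t)`. The vector `q` is orthogonal to `u = M e`, and `r` to
  -- `M p`; hence `rot 1 q = u` and `rot 1 r = M p`. The last condition becomes `u · M² p = 0`, so
  -- `p` is taken orthogonal to `w = M² u`. By Cayley-Hamilton, `w` and `u` are independent once the
  -- determinant and trace of `M` are nonzero and `e` is not an eigenvector, which is `hne`.
  refine ⟨![-w₁, w₀], ![u₁, -u₀], ![-w₁ * B + w₀ * C, -(-w₁ * A + w₀ * B)],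
    hpos _ ?_, hpos _ ?_, hpos _ ?_, ?_, ?_, ?_, ?_⟩
  · simp only [Matrix.cons_val_zero, Matrix.cons_val_one]
    intro h0 h1
    rw [neg_eq_zero] at h0
    exact hne (by rw [h0, h1]; ring)
  · simp only [Matrix.cons_val_zero, Matrix.cons_val_one]
    intro h0 h1
    rw [neg_eq_zero] at h1
    exact hne (by rw [h0, h1]; ring)
  · simp only [Matrix.cons_val_zero, Matrix.cons_val_one]
    intro h0 h1
    refine hne ?_
    have : w₀ * u₁ - w₁ * u₀ = -(-(-w₁ * A + w₀ * B)) + t * (-w₁ * B + w₀ * C) := by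
      rw [hu₀, hu₁]; ring
    rw [this, h0, h1]; ring
  · have : symForm A B C ![-w₁, w₀] ![1, t] = w₀ * u₁ - w₁ * u₀ := by
      simp [symForm, hu₀, hu₁]; ring
    rwa [this]
  · simp [symForm, hu₀, hu₁]; ring
  · simp [symForm]; ring
  · simp [symForm, rot]
    rw [hw₀, hw₁]; ring

lemma dicke_hardy_violation {n k : ℕ} (hn : n ≠ 0) (hk : k ≤ n) :
    ∃ E : LocalMeasurements (fun _ : Fin (n + 2) => 2) 2 2,
      0 < bellValue (hardyBell 0)
        (Matrix.vecMulVec (dicke (n + 2) (k + 1)) (star (dicke (n + 2) (k + 1)))) E := by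
  -- Any `t > 0` with `t² - 1 > k` would do.
  set t : ℝ := n + 2 with ht
  have htpos : 0 < t := by positivity
  set A : ℝ := n.choose (k + 1) * t ^ (k + 1) with hA
  set B : ℝ := n.choose k * t ^ k with hB
  set C : ℝ := if k = 0 then 0 else n.choose (k - 1) * t ^ (k - 1) with hC
  have hBpos : 0 < B := mul_pos (by exact_mod_cast Nat.choose_pos hk) (by positivity)
  have hA0 : 0 ≤ A := by positivity
  have hC0 : 0 ≤ C := by rw [hC]; split_ifs <;> positivity
  have hkn : (k : ℝ) ≤ n := by exact_mod_cast hk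
  have hk0 : (0 : ℝ) ≤ k := Nat.cast_nonneg k
  have hAB : (k + 1) * A = (n - k) * (t * B) := by
    have h := Nat.choose_succ_right_eq n k
    have h' : (n.choose (k + 1) : ℝ) * (k + 1) = n.choose k * (n - k) := by
      rw [← Nat.cast_sub hk]; exact_mod_cast h
    rw [hA, hB, pow_succ]
    linear_combination t ^ k * t * h'
  have hCB : (n - k + 1) * (t * C) = k * B := by
    rcases k with _ | k
    · simp [hC]
    · have h := Nat.choose_succ_right_eq n k
      have h' : (n.choose (k + 1) : ℝ) * (k + 1) = n.choose k * (n - k) := by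
        rw [← Nat.cast_sub (by omega)]; exact_mod_cast h
      simp only [hC, hB, Nat.add_sub_cancel, Nat.succ_ne_zero, if_false, pow_succ]
      push_cast
      linear_combination -(t ^ k * t) * h'
  -- Strict log-concavity of binomial coefficients: `AC / B² = k(n - k) / ((k + 1)(n - k + 1)) < 1`.
  have hdet : A * C ≠ B ^ 2 := by
    have h : (k + 1) * (n - k + 1) * t * (A * C) = k * (n - k) * t * B ^ 2 := by
      linear_combination (n - k + 1) * (t * C) * hAB + (n - k) * t * B * hCB
    intro h'
    rw [h'] at h
    have : 0 < (n + 1 : ℝ) * (t * B ^ 2) := by positivity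
    nlinarith
  -- Vanishing of both entries would force `k = n` and `k = 0`, hence `n = 0`.
  have hAC : A + C ≠ 0 := by
    intro h
    obtain ⟨h1, h2⟩ := (add_eq_zero_iff_of_nonneg hA0 hC0).1 h
    rw [h1] at hAB
    rw [h2] at hCB
    have hnk : (n : ℝ) - k = 0 := by
      have := mul_pos htpos hBpos
      rcases mul_eq_zero.1 (by linarith : ((n : ℝ) - k) * (t * B) = 0) with h | h
      · exact h
      · exact absurd h this.ne'
    have hk00 : (k : ℝ) = 0 := by
      rcases mul_eq_zero.1 (by linarith : (k : ℝ) * B = 0) with h | h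
      · exact h
      · exact absurd h hBpos.ne'
    apply hn
    exact_mod_cast (by linarith : (n : ℝ) = 0)
  -- The expression is negative, since `tC ≤ kB < (t² - 1)B` and `A ≥ 0`.
  have hne : B * (1 - t ^ 2) + (C - A) * t ≠ 0 := by
    have h1 : t * C ≤ k * B := by
      rw [← hCB]
      nlinarith [mul_nonneg (sub_nonneg.2 hkn) (mul_nonneg htpos.le hC0)]
    have h2 : (k : ℝ) < t ^ 2 - 1 := by rw [ht]; nlinarith
    nlinarith [mul_lt_mul_of_pos_right h2 hBpos, mul_nonneg hA0 htpos.le]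
  obtain ⟨p, q, r, hp, hq, hr, h0, h1, h2, h3⟩ := exists_hardy hdet hAC hne
  have hw := starVectors_pos (0 : Fin (n + 2)) t hp hq hr
  refine ⟨realMeasurements _ hw, ?_⟩
  have key := fun j (hj : (0 : Fin (n + 2)) ≠ j) => bornProb_starVectors (k := k) hj hw
  have hz : ∀ j : Fin (n + 2), 0 ≠ j → pairString 0 j 0 0 = 0 := by
    intro j hj; rw [pairString_zero hj]; simp
  have h01 : (0 : Fin (n + 2)) ≠ 1 := by simp
  rw [bellValue_hardyBell, Finset.sum_eq_zero, ← pairString_zero h01, ← hz 1 h01, key 1 h01,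
    key 1 h01]
  · rw [← hA, ← hB, ← hC]
    simp only [rot, Fin.isValue, if_true, one_ne_zero, if_false, h1]
    have hpr : 0 < ∏ l, (starVectors 0 t p q r l (pairString 0 1 0 0 l) 0 ^ 2
        + starVectors 0 t p q r l (pairString 0 1 0 0 l) 1 ^ 2)⁻¹ :=
      Finset.prod_pos fun l _ => inv_pos.2 (hw l _)
    have hch : (0 : ℝ) < (n + 2).choose (k + 1) := by
      exact_mod_cast Nat.choose_pos (by omega)
    have : 0 < symForm A B C p ![1, t] ^ 2 := by positivity
    simp only [ne_eq, OfNat.ofNat_ne_zero, not_false_eq_true, zero_pow, mul_zero, sub_zero]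
    positivity
  · intro j hj
    have hj' : (0 : Fin (n + 2)) ≠ j := (Finset.ne_of_mem_erase hj).symm
    have e1 := key j hj' 0 1 0 0
    have e2 := key j hj' 1 1 1 1
    rw [hz j hj', ← hA, ← hB, ← hC] at e1
    rw [← hA, ← hB, ← hC] at e2
    simp only [one_ne_zero, if_false, h3] at e2
    simp only [rot, one_ne_zero, if_false, if_true, h2] at e1
    rw [e1, e2]
    simp

/-- For `N = 2` the matrix is `!![0, 1; 1, 0]`, with trace 0, so `exists_hardy` does not apply. The
chosen vectors give the value `(4/5 - 1/5 - 1/5 - 4/125) / 2 = 23/125`. -/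
lemma dicke_two_one_violation : ∃ E : LocalMeasurements (fun _ : Fin (0 + 2) => 2) 2 2,
    0 < bellValue (hardyBell 0)
      (Matrix.vecMulVec (dicke (0 + 2) (0 + 1)) (star (dicke (0 + 2) (0 + 1)))) E := by
  have hw := starVectors_pos (0 : Fin (0 + 2)) 2 (p := ![1, 0]) (q := ![4, -3]) (r := ![2, 1])
    (by norm_num) (by norm_num) (by norm_num)
  refine ⟨realMeasurements _ hw, ?_⟩
  have h01 : (0 : Fin (0 + 2)) ≠ 1 := by simp
  have key := bornProb_starVectors (n := 0) (k := 0) h01 hw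
  have hz : pairString (0 : Fin (0 + 2)) 1 0 0 = 0 := by rw [pairString_zero h01]; simp
  have he : (Finset.univ.erase (0 : Fin (0 + 2))) = {1} := by decide
  have e1 := key 0 0 0 0
  have e2 := key 1 0 0 0
  have e3 := key 0 1 0 0
  have e4 := key 1 1 1 1
  rw [hz] at e1 e2 e3
  rw [pairString_zero h01 1] at e2
  rw [bellValue_hardyBell, he, Finset.sum_singleton, e1, e2, e3, e4]
  simp only [← pairString_zero h01]
  simp [Fin.prod_univ_two, starVectors, pairString, symForm, rot]
  norm_num

lemma dicke_diDetectable {N k : ℕ} (hk1 : 1 ≤ k) (hkN : k ≤ N - 1) :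
    DIDetectable (fun _ : Fin N => 2) (dicke N k) := by
  obtain ⟨n, rfl⟩ : ∃ n, N = n + 2 := ⟨N - 2, by omega⟩
  obtain ⟨k, rfl⟩ : ∃ l, k = l + 1 := ⟨k - 1, by omega⟩
  refine ⟨2, 2, hardyBell 0, 0, fun d ρ E hρ => bellValue_hardyBell_le hρ E 0, ?_⟩
  by_cases hn : n = 0
  · subst hn
    obtain rfl : k = 0 := by omega
    exact dicke_two_one_violation
  · exact dicke_hardy_violation hn (by omega)

end DickeGME

theorem mainTheorem5 (N k : ℕ) (hk1 : 1 ≤ k) (hkN : k ≤ N - 1) :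
    (∀ i j : Fin N, i ≠ j →
      ∀ l : List (Fin N), l.Nodup → (∀ p, p ∈ l ↔ p ≠ i ∧ p ≠ j) →
        (DickeGME.zxProtocol k l).EveryBranch
          (fun ψ => ∃ (a : ℝ) (e : Fin 2), a ≠ 0 ∧ 2 * a ^ 2 ≤ 1 ∧
            DickeGME.PairInState ψ i j (DickeGME.chi a e) ∧
            DickeGME.EntangledPair (DickeGME.chi a e))
          (DickeGME.dicke N k)) ∧
    DickeGME.DIDetectable (fun _ : Fin N => 2) (DickeGME.dicke N k) := by
  exact ⟨fun i j hij l hl hmem => DickeGME.dicke_everyBranch hk1 hkN hij l hl hmem,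
    DickeGME.dicke_diDetectable hk1 hkN⟩
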